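/- A matrix $A\in\mathbb{R}^{n\times N}$ satisfies the restricted isometry property (RIP) of order $s$ with constant $\delta$ if $(1-\delta)\|z\|_2^2\le\|A_Tz\|_2^2\le(1+\delta)\|z\|_2^2$ for all $T\subset\{1,\dots,N\}$ with $|T|\le s$ and all $z\in\mathbb{R}^{|T|}$, where $A_T$ consists of the columns of $A$ indexed by $T$. For every $\delta\in(0,1)$ there exist constants $c_1,c_2>0$ depending only on $\delta$ such that the following holds. Let $m,d,e\ge 1$ and $1\le l\le k$ be integers, put $n=ld$ and $N=ke$, and suppose $3m\le N$. Let $$\Phi=\begin{pmatrix}\Phi_k&\Phi_{k-1}&\cdots&\Phi_2&\Phi_1\\ \Phi_1&\Phi_k&\cdots&\Phi_3&\Phi_2\\ \vdots&\vdots&&\vdots&\vdots\\ \Phi_{l-1}&\Phi_{l-2}&\cdots&\cdots&\Phi_l\end{pmatrix}\in\mathbb{R}^{n\times N}$$ be the matrix of the first $l$ block rows of the circulant block matrix with blocks $\Phi_1,\dots,\Phi_k\in\mathbb{R}^{d\times e}$ (block indices are taken modulo $k$), where all $kde$ entries of the blocks $\Phi_1,\dots,\Phi_k$ are independent and identically distributed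 with one of the following three laws: the normal law $N(0,1/n)$; the law giving probability $1/2$ to each of $\pm1/\sqrt n$; the law giving probability $1/6$ to each of $\pm\sqrt{3/n}$ and probability $2/3$ to $0$. Then: (i) If $l\le 3m(3m-1)$ and $n\ge c_1\,l\,m\ln(N/m)$, then $\Phi$ satisfies RIP of order $3m$ with constant $\delta$ with probability at least $1-e^{-c_2n/l}$. (ii) If $l>3m(3m-1)$ and $n\ge c_1\,m^3\ln(N/m)$, then $\Phi$ satisfies RIP of order $3m$ with constant $\delta$ with probability at least $1-e^{-c_2n/m^2}$. -/

import Mathlib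

open MeasureTheory ProbabilityTheory

/-- The restricted isometry property of order `s` with constant `δ`: every submatrix `A_T` formed
by a set `T` of at most `s` columns is a `δ`-near-isometry for the Euclidean norms. -/
def SatisfiesRIP {ι κ : Type*} [Fintype ι] (A : Matrix ι κ ℝ) (s : ℕ) (δ : ℝ) : Prop :=
  ∀ T : Finset κ, T.card ≤ s → ∀ z : EuclideanSpace ℝ T,
    (1 - δ) * ‖z‖ ^ 2
        ≤ ‖WithLp.toLp 2 ((A.submatrix id (fun t : T => (t : κ))).mulVec z.ofLp)‖ ^ 2 ∧
      ‖WithLp.toLp 2 ((A.submatrix id (fun t : T => (t : κ))).mulVec z.ofLp)‖ ^ 2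
        ≤ (1 + δ) * ‖z‖ ^ 2

/-- The symmetric law on `{1/√n, -1/√n}`. -/
noncomputable def signLaw (n : ℕ) : Measure ℝ :=
  ENNReal.ofReal (1 / 2) • Measure.dirac (1 / √(n : ℝ)) +
    ENNReal.ofReal (1 / 2) • Measure.dirac (-(1 / √(n : ℝ)))

/-- The symmetric law on `{√(3/n), 0, -√(3/n)}` with weights `1/6, 2/3, 1/6`. -/
noncomputable def sparseSignLaw (n : ℕ) : Measure ℝ :=
  ENNReal.ofReal (1 / 6) • Measure.dirac √(3 / (n : ℝ)) +
    ENNReal.ofReal (2 / 3) • Measure.dirac (0 : ℝ) +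
    ENNReal.ofReal (1 / 6) • Measure.dirac (-√(3 / (n : ℝ)))

/-- The three admissible entry laws for a matrix with `n` rows: `N(0, 1/n)`, the sign law and the
sparse sign law. -/
def IsEntryLaw (n : ℕ) (ν : Measure ℝ) : Prop :=
  ν = gaussianReal 0 (1 / (n : NNReal)) ∨ ν = signLaw n ∨ ν = sparseSignLaw n

/-- The block matrix with `l` block rows and `k` block columns whose block in position `(r, c)`
(both counted from `0`) is `B (r - c)`, indices being taken modulo `k`. As `B_0 = B_k`, the first
block row is `B_k, B_{k-1}, …, B_1`, the second one is `B_1, B_k, …, B_2`, and so on: for `l ≤ k`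
these are the first `l` block rows of a circulant block matrix. -/
def circulantBlock {d e : ℕ} (l k : ℕ) (B : ZMod k → Matrix (Fin d) (Fin e) ℝ) :
    Matrix (Fin l × Fin d) (Fin k × Fin e) ℝ :=
  Matrix.of fun p q =>
    B (((p.1 : ℕ) : ZMod k) - ((q.1 : ℕ) : ZMod k)) p.2 q.2

/-! Fix a column set `T` and a vector `z`. After rescaling, the coordinates of `Φ_T z` are linear
forms with unit coefficient vectors in independent centred entries of variance one and sub-Gaussian
parameter 3, so each square has mean one and a controlled exponential moment. The forms are
dependent, since blocks recur in different rows. Colour the rows so that rows of one colour share no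
entry in the columns `T`: within a colour the forms are independent, and convexity of `exp` combines
the colours (`exp_sum_sq_sub_one_of_coloring`). With `χ` colours this costs a factor `χ` in the
exponent: `‖Φ_T z‖²` deviates from `‖z‖²` by `ε‖z‖²` with probability at most `2 exp(-c ε² n / χ)`.

Two colourings are available: by block row, with `l` colours (`isRowColoring_fst`), and a greedy one
with `3m(3m-1)+1` colours, at most `9m²` (`exists_isRowColoring`). They give (i) and (ii)
respectively.

A `1/4`-net of each unit ball and a union bound over the sets `T` make the estimate uniform, at a
cost `exp(O(m ln(N/m)))` that the assumption on `n` absorbs (`union_bound_le`). -/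

/-! ### Exponential moments of squares of sub-Gaussian variables. -/

theorem Real.exp_le_one_add_add_sq_mul_exp_abs (y : ℝ) :
    Real.exp y ≤ 1 + y + y ^ 2 * Real.exp |y| := by
  have h := Complex.norm_exp_sub_sum_le_norm_mul_exp (y : ℂ) 2
  have h1 : Complex.exp y - ∑ m ∈ Finset.range 2, (y : ℂ) ^ m / m.factorial
      = ((Real.exp y - (1 + y) : ℝ) : ℂ) := by
    simp [Finset.sum_range_succ]
  rw [h1, Complex.norm_real, Complex.norm_real, Real.norm_eq_abs, Real.norm_eq_abs, sq_abs] at h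
  have := le_abs_self (Real.exp y - (1 + y))
  linarith

theorem lintegral_exp_sq_gaussianReal :
    ∫⁻ t, ENNReal.ofReal (Real.exp (3 * t ^ 2 / 2)) ∂(gaussianReal 0 (1 / 4)) = 2 := by
  have hv : (1 / 4 : NNReal) ≠ 0 := by norm_num
  rw [gaussianReal_of_var_ne_zero _ hv, lintegral_withDensity_eq_lintegral_mul _
    (measurable_gaussianPDF _ _) (by fun_prop)]
  have h1 : ∀ t : ℝ, (gaussianPDF 0 (1 / 4) * fun t ↦ ENNReal.ofReal (Real.exp (3 * t ^ 2 / 2))) t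
      = ENNReal.ofReal ((√(Real.pi / 2))⁻¹ * Real.exp (-(1 / 2) * t ^ 2)) := by
    intro t
    simp only [Pi.mul_apply, gaussianPDF, gaussianPDFReal]
    rw [← ENNReal.ofReal_mul (by positivity)]
    congr 1
    rw [mul_assoc, ← Real.exp_add]
    push_cast
    congr 3
    · ring_nf
    · ring
  simp_rw [h1]
  rw [← ofReal_integral_eq_lintegral_ofReal]
  · rw [integral_const_mul, integral_gaussian, ← Real.sqrt_inv, ← Real.sqrt_mul (by positivity)]
    have : (Real.pi / 2)⁻¹ * (Real.pi / (1 / 2)) = 2 ^ 2 := by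
      field_simp
    rw [this, Real.sqrt_sq (by norm_num)]
    simp
  · exact (integrable_exp_neg_mul_sq (by norm_num)).const_mul _
  · exact ae_of_all _ fun t => by positivity

theorem lintegral_exp_mul_gaussianReal (x : ℝ) :
    ∫⁻ t, ENNReal.ofReal (Real.exp (t * x)) ∂(gaussianReal 0 (1 / 4)) =
      ENNReal.ofReal (Real.exp (x ^ 2 / 8)) := by
  have h := congrFun (mgf_fun_id_gaussianReal (μ := 0) (v := 1 / 4)) x
  simp only [mgf] at h
  rw [← ofReal_integral_eq_lintegral_ofReal]
  · congr 1
    simp_rw [mul_comm _ x]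
    rw [h]
    congr 1
    push_cast
    ring
  · simpa [mul_comm] using integrable_exp_mul_gaussianReal (μ := 0) (v := 1 / 4) x
  · exact ae_of_all _ fun t => by positivity

section

variable {Ω : Type*} [MeasurableSpace Ω] {μ : Measure Ω} {X : Ω → ℝ}

/-- The square is linearised by an auxiliary Gaussian: `exp(x²/8)` is the mean of `exp(t x)` for `t`
of law `N(0, 1/4)`. After swapping integrals, the sub-Gaussian bound `exp(3t²/2)` is integrated
against that law, which gives exactly 2. -/
theorem ProbabilityTheory.HasSubgaussianMGF.lintegral_exp_sq_le [IsProbabilityMeasure μ]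
    (h : HasSubgaussianMGF X 3 μ) :
    ∫⁻ ω, ENNReal.ofReal (Real.exp (X ω ^ 2 / 8)) ∂μ ≤ 2 := by
  have hX := h.aemeasurable
  simp_rw [← lintegral_exp_mul_gaussianReal]
  rw [lintegral_lintegral_swap (by fun_prop), ← lintegral_exp_sq_gaussianReal]
  refine lintegral_mono fun t => ?_
  rw [← ofReal_integral_eq_lintegral_ofReal (h.integrable_exp_mul t)
    (ae_of_all _ fun t => by positivity)]
  refine ENNReal.ofReal_le_ofReal ?_
  simpa [mgf] using h.mgf_le t

theorem ProbabilityTheory.HasSubgaussianMGF.integrable_exp_sq [IsProbabilityMeasure μ]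
    (h : HasSubgaussianMGF X 3 μ) : Integrable (fun ω => Real.exp (X ω ^ 2 / 8)) μ := by
  have hX := h.aemeasurable
  refine ⟨(by fun_prop : AEMeasurable _ μ).aestronglyMeasurable, ?_⟩
  rw [hasFiniteIntegral_iff_ofReal (ae_of_all _ fun t => by positivity)]
  exact h.lintegral_exp_sq_le.trans_lt (by simp)

theorem ProbabilityTheory.HasSubgaussianMGF.integral_exp_sq_le [IsProbabilityMeasure μ]
    (h : HasSubgaussianMGF X 3 μ) : ∫ ω, Real.exp (X ω ^ 2 / 8) ∂μ ≤ 2 := by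
  have := h.lintegral_exp_sq_le
  rw [← ofReal_integral_eq_lintegral_ofReal h.integrable_exp_sq
    (ae_of_all _ fun t => by positivity)] at this
  simpa using (ENNReal.ofReal_le_iff_le_toReal (by simp)).1 this

/-- A second-order Taylor bound. With `y = (x²+1)/16`, both the remainder's exponential and, through
`y²/2 ≤ exp y`, its polynomial factor are controlled by `exp y`; their product is `exp(1/8)
exp(x²/8)`, and `512 * exp(1/8) ≤ 1024`. -/
theorem exp_mul_sq_sub_one_le {t x : ℝ} (ht : |t| ≤ 1 / 16) :
    Real.exp (t * (x ^ 2 - 1)) ≤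
      1 + t * (x ^ 2 - 1) + t ^ 2 * (1024 * Real.exp (x ^ 2 / 8)) := by
  refine (Real.exp_le_one_add_add_sq_mul_exp_abs _).trans (add_le_add_right ?_ _)
  have hx := sq_nonneg x
  have hu : |x ^ 2 - 1| ≤ x ^ 2 + 1 := by rw [abs_le]; constructor <;> linarith
  have h1 : |t * (x ^ 2 - 1)| ≤ (x ^ 2 + 1) / 16 := by
    rw [abs_mul]
    calc |t| * |x ^ 2 - 1| ≤ 1 / 16 * (x ^ 2 + 1) := by gcongr
      _ = _ := by ring
  have h2 : (x ^ 2 - 1) ^ 2 ≤ 512 * Real.exp ((x ^ 2 + 1) / 16) := by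
    have h3 := Real.quadratic_le_exp_of_nonneg (x := (x ^ 2 + 1) / 16) (by positivity)
    nlinarith
  have h4 : Real.exp (1 / 8) ≤ 2 := by
    have := Real.exp_one_lt_d9
    have h5 : Real.exp (1 / 8) ^ 8 = Real.exp 1 := by rw [← Real.exp_nat_mul]; norm_num
    by_contra! hc
    have : (2 : ℝ) ^ 8 < Real.exp (1 / 8) ^ 8 := by gcongr
    norm_num at this
    linarith
  calc (t * (x ^ 2 - 1)) ^ 2 * Real.exp |t * (x ^ 2 - 1)|
      = t ^ 2 * ((x ^ 2 - 1) ^ 2 * Real.exp |t * (x ^ 2 - 1)|) := by ring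
    _ ≤ t ^ 2 * (512 * Real.exp ((x ^ 2 + 1) / 16) * Real.exp ((x ^ 2 + 1) / 16)) := by gcongr
    _ = t ^ 2 * (512 * (Real.exp (1 / 8) * Real.exp (x ^ 2 / 8))) := by
      rw [mul_assoc 512, ← Real.exp_add, ← Real.exp_add]; ring_nf
    _ ≤ t ^ 2 * (512 * (2 * Real.exp (x ^ 2 / 8))) := by gcongr
    _ = _ := by ring

theorem ProbabilityTheory.HasSubgaussianMGF.integrable_exp_mul_sq_sub_one [IsProbabilityMeasure μ]
    (h : HasSubgaussianMGF X 3 μ) {t : ℝ} (ht : |t| ≤ 1 / 16) :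
    Integrable (fun ω => Real.exp (t * (X ω ^ 2 - 1))) μ := by
  have hX := h.aemeasurable
  have hsq : Integrable (fun ω => X ω ^ 2) μ := by
    simpa using (h.memLp 2).integrable_sq
  refine Integrable.mono' (((integrable_const (1 : ℝ)).add
    ((hsq.sub (integrable_const (1 : ℝ))).const_mul t)).add
      ((h.integrable_exp_sq.const_mul 1024).const_mul (t ^ 2)))
    (by fun_prop : AEMeasurable _ μ).aestronglyMeasurable (ae_of_all _ fun ω => ?_)
  rw [Real.norm_of_nonneg (Real.exp_pos _).le]
  exact exp_mul_sq_sub_one_le ht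

theorem ProbabilityTheory.HasSubgaussianMGF.mgf_sq_sub_one_le [IsProbabilityMeasure μ]
    (h : HasSubgaussianMGF X 3 μ) (hvar : ∫ ω, X ω ^ 2 ∂μ = 1) {t : ℝ} (ht : |t| ≤ 1 / 16) :
    mgf (fun ω => X ω ^ 2 - 1) μ t ≤ Real.exp (2048 * t ^ 2) := by
  have hsq : Integrable (fun ω => X ω ^ 2) μ := by
    simpa using (h.memLp 2).integrable_sq
  have i1 : Integrable (fun ω => t * (X ω ^ 2 - 1)) μ :=
    (hsq.sub (integrable_const (1 : ℝ))).const_mul t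
  have i2 : Integrable (fun ω => 1 + t * (X ω ^ 2 - 1)) μ := (integrable_const (1 : ℝ)).add i1
  have i3 : Integrable (fun ω => t ^ 2 * (1024 * Real.exp (X ω ^ 2 / 8))) μ :=
    (h.integrable_exp_sq.const_mul 1024).const_mul (t ^ 2)
  calc mgf (fun ω => X ω ^ 2 - 1) μ t
      ≤ ∫ ω, (1 + t * (X ω ^ 2 - 1) + t ^ 2 * (1024 * Real.exp (X ω ^ 2 / 8))) ∂μ :=
        integral_mono (h.integrable_exp_mul_sq_sub_one ht) (i2.add i3)
          fun ω => exp_mul_sq_sub_one_le ht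
    -- Unit variance kills the term linear in `t`.
    _ = 1 + t ^ 2 * (1024 * ∫ ω, Real.exp (X ω ^ 2 / 8) ∂μ) := by
        rw [integral_add i2 i3, integral_add (integrable_const _) i1, integral_const_mul,
          integral_const_mul, integral_const_mul, integral_sub hsq (integrable_const _), hvar]
        simp
    _ ≤ 1 + t ^ 2 * (1024 * 2) := by gcongr; exact h.integral_exp_sq_le
    _ = 2048 * t ^ 2 + 1 := by ring
    _ ≤ _ := Real.add_one_le_exp _

end

/-! ### Sums of squares of linear forms with coloured dependence. -/

section

variable {Ω : Type*} [MeasurableSpace Ω] {μ : Measure Ω} {ι κ : Type*} [Fintype ι]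
  {ξ : ι → Ω → ℝ}

/-- Linear forms with disjoint supports in independent variables are independent. -/
theorem ProbabilityTheory.iIndepFun.indepFun_sum_comp_linear (hξ : iIndepFun ξ μ)
    (hm : ∀ p, AEMeasurable (ξ p) μ) {φ : ℝ → ℝ} (hφ : Measurable φ) (w : κ → ι → ℝ)
    (s : Finset κ) (j : κ) (hd : ∀ i ∈ s, ∀ p, w i p * w j p = 0) :
    IndepFun (fun ω => ∑ i ∈ s, φ (∑ p, w i p * ξ p ω)) (fun ω => φ (∑ p, w j p * ξ p ω)) μ := by
  classical
  let S : Finset ι := {p | w j p = 0}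
  let T : Finset ι := {p | w j p ≠ 0}
  have hST : Disjoint S T := Finset.disjoint_filter_filter_not _ _ _
  have hS : ∀ i ∈ s, ∀ ω, ∑ p, w i p * ξ p ω = ∑ p : S, w i p * ξ p ω := by
    intro i hi ω
    rw [Finset.sum_coe_sort S fun p => w i p * ξ p ω]
    refine (Finset.sum_subset (Finset.subset_univ _) fun p _ hp => ?_).symm
    have : w j p ≠ 0 := by simpa [S] using hp
    have : w i p = 0 := (mul_eq_zero.1 (hd i hi p)).resolve_right this
    simp [this]
  have hT : ∀ ω, ∑ p, w j p * ξ p ω = ∑ p : T, w j p * ξ p ω := by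
    intro ω
    rw [Finset.sum_coe_sort T fun p => w j p * ξ p ω]
    refine (Finset.sum_subset (Finset.subset_univ _) fun p _ hp => ?_).symm
    have : w j p = 0 := by simpa [T] using hp
    simp [this]
  have h := (hξ.indepFun_finset₀ S T hST hm).comp
    (φ := fun v : S → ℝ => ∑ i ∈ s, φ (∑ p : S, w i p * v p))
    (ψ := fun v : T → ℝ => φ (∑ p : T, w j p * v p)) (by fun_prop) (by fun_prop)
  convert h using 1
  · funext ω
    exact Finset.sum_congr rfl fun i hi => by rw [hS i hi]
  · funext ω
    rw [hT]; rfl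

/-- The case of a single colour: disjoint supports make the moment generating functions multiply. -/
theorem exp_sum_sq_sub_one_of_disjoint [IsProbabilityMeasure μ] (hξ : iIndepFun ξ μ)
    (hm : ∀ p, AEMeasurable (ξ p) μ) (w : κ → ι → ℝ)
    (hsub : ∀ i, HasSubgaussianMGF (fun ω => ∑ p, w i p * ξ p ω) 3 μ)
    (hvar : ∀ i, ∫ ω, (∑ p, w i p * ξ p ω) ^ 2 ∂μ = 1)
    (s : Finset κ) (hd : ∀ i ∈ s, ∀ j ∈ s, i ≠ j → ∀ p, w i p * w j p = 0)
    {t : ℝ} (ht : |t| ≤ 1 / 16) :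
    Integrable (fun ω => Real.exp (t * ∑ i ∈ s, ((∑ p, w i p * ξ p ω) ^ 2 - 1))) μ ∧
      ∫ ω, Real.exp (t * ∑ i ∈ s, ((∑ p, w i p * ξ p ω) ^ 2 - 1)) ∂μ ≤
        Real.exp (2048 * s.card * t ^ 2) := by
  classical
  induction s using Finset.induction_on with
  | empty => simp
  | insert j s hj ih =>
    obtain ⟨ih1, ih2⟩ := ih fun i hi i' hi' => hd i (by simp [hi]) i' (by simp [hi'])
    have hind := hξ.indepFun_sum_comp_linear hm (φ := fun x => x ^ 2 - 1) (by fun_prop) w s j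
      fun i hi p => hd i (by simp [hi]) j (by simp) (by rintro rfl; exact hj hi) p
    have hj1 := (hsub j).integrable_exp_mul_sq_sub_one ht
    have hj2 := (hsub j).mgf_sq_sub_one_le (hvar j) ht
    have hrw : ∀ ω, ∑ i ∈ insert j s, ((∑ p, w i p * ξ p ω) ^ 2 - 1) =
        ((fun ω => ∑ i ∈ s, ((∑ p, w i p * ξ p ω) ^ 2 - 1) : Ω → ℝ) +
          (fun ω => ((∑ p, w j p * ξ p ω) ^ 2 - 1) : Ω → ℝ)) ω := by
      intro ω
      rw [Finset.sum_insert hj, add_comm]; rfl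
    simp_rw [hrw]
    refine ⟨hind.integrable_exp_mul_add ih1 hj1, ?_⟩
    have := hind.mgf_add ih1.aestronglyMeasurable hj1.aestronglyMeasurable
    rw [mgf] at this
    rw [this]
    calc _ ≤ Real.exp (2048 * s.card * t ^ 2) * Real.exp (2048 * t ^ 2) :=
          mul_le_mul ih2 hj2 mgf_nonneg (Real.exp_pos _).le
      _ = _ := by
          rw [← Real.exp_add, Finset.card_insert_of_notMem hj]; push_cast; ring_nf

/-- Moment generating function bound for a sum of centred squares of unit linear forms that can be
coloured so that forms of the same colour have disjoint supports. -/
theorem exp_sum_sq_sub_one_of_coloring [IsProbabilityMeasure μ] [Fintype κ] [Nonempty κ]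
    (hξ : iIndepFun ξ μ)
    (hm : ∀ p, AEMeasurable (ξ p) μ) (w : κ → ι → ℝ)
    (hsub : ∀ i, HasSubgaussianMGF (fun ω => ∑ p, w i p * ξ p ω) 3 μ)
    (hvar : ∀ i, ∫ ω, (∑ p, w i p * ξ p ω) ^ 2 ∂μ = 1)
    {χ : ℕ} (f : κ → Fin χ) (hd : ∀ i j, i ≠ j → f i = f j → ∀ p, w i p * w j p = 0)
    {t : ℝ} (ht : |t| ≤ 1 / (32 * χ)) :
    Integrable (fun ω => Real.exp (t * ∑ i, ((∑ p, w i p * ξ p ω) ^ 2 - 1))) μ ∧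
      ∫ ω, Real.exp (t * ∑ i, ((∑ p, w i p * ξ p ω) ^ 2 - 1)) ∂μ ≤
        Real.exp (8192 * Fintype.card κ * χ * t ^ 2) := by
  classical
  have hχ : 0 < (χ : ℝ) := by
    have : 0 < χ := Fin.pos (f (Classical.arbitrary κ))
    exact_mod_cast this
  set n : ℝ := (Fintype.card κ : ℝ) with hn
  have hn0 : 0 < n := by rw [hn]; exact_mod_cast Fintype.card_pos
  let C : Fin χ → Finset κ := fun j => {i | f i = j}
  -- Jensen weights averaging the class proportions with the uniform distribution. The uniform half
  -- keeps `t / q j` within the admissible range `1/16` even for small classes; the proportional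
  -- half bounds the class size by `2 n q j`.
  let q : Fin χ → ℝ := fun j => ((C j).card / n + 1 / χ) / 2
  have hq1 : ∀ j, 1 / (2 * χ) ≤ q j := fun j => by
    have : (0 : ℝ) ≤ (C j).card / n := by positivity
    have h2 : 1 / (2 * (χ : ℝ)) = (1 / χ) / 2 := by field_simp
    simp only [q]; linarith
  have hq0 : ∀ j, 0 < q j := fun j => lt_of_lt_of_le (by positivity) (hq1 j)
  have hqC : ∀ j, ((C j).card : ℝ) ≤ 2 * n * q j := fun j => by
    have : 2 * n * q j = (C j).card + n / χ := by simp only [q]; field_simp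
    rw [this]
    have : 0 ≤ n / χ := by positivity
    linarith
  have hqs : ∑ j, q j = 1 := by
    have hc : ∑ j, ((C j).card : ℝ) = n := by
      rw [hn, ← Finset.card_univ, ← Nat.cast_sum]
      congr 1
      exact (Finset.card_eq_sum_card_fiberwise fun i _ => Finset.mem_coe.2 (Finset.mem_univ _)).symm
    simp only [q]
    rw [← Finset.sum_div, Finset.sum_add_distrib, ← Finset.sum_div, hc]
    simp
    field_simp
    norm_num
  let S : Fin χ → Ω → ℝ := fun j ω => ∑ i ∈ C j, ((∑ p, w i p * ξ p ω) ^ 2 - 1)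
  have hS : ∀ ω, ∑ i, ((∑ p, w i p * ξ p ω) ^ 2 - 1) = ∑ j, S j ω := fun ω =>
    (Finset.sum_fiberwise _ f _).symm
  have hle : ∀ ω, Real.exp (t * ∑ i, ((∑ p, w i p * ξ p ω) ^ 2 - 1)) ≤
      ∑ j, q j * Real.exp (t / q j * S j ω) := fun ω => by
    have := convexOn_exp.map_sum_le (t := Finset.univ) (w := q) (p := fun j => t / q j * S j ω)
      (fun j _ => (hq0 j).le) hqs (fun _ _ => Set.mem_univ _)
    simp only [smul_eq_mul] at this
    refine le_of_eq_of_le (congrArg Real.exp ?_) this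
    rw [hS, Finset.mul_sum]
    refine Finset.sum_congr rfl fun j _ => ?_
    have := (hq0 j).ne'
    field_simp
  have hcls := fun j => exp_sum_sq_sub_one_of_disjoint hξ hm w hsub hvar (C j)
    (fun i hi i' hi' hne => hd i i' hne (by simp_all [C])) (t := t / q j) (by
      rw [abs_div, abs_of_pos (hq0 j), div_le_iff₀ (hq0 j)]
      calc |t| ≤ 1 / (32 * χ) := ht
        _ = 1 / 16 * (1 / (2 * χ)) := by field_simp; norm_num
        _ ≤ _ := by gcongr; exact hq1 j)
  have hint : Integrable (fun ω => ∑ j, q j * Real.exp (t / q j * S j ω)) μ :=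
    integrable_finsetSum _ fun j _ => (hcls j).1.const_mul _
  have hmeas : AEMeasurable
      (fun ω => Real.exp (t * ∑ i, ((∑ p, w i p * ξ p ω) ^ 2 - 1))) μ := by fun_prop
  have hInt : Integrable (fun ω => Real.exp (t * ∑ i, ((∑ p, w i p * ξ p ω) ^ 2 - 1))) μ :=
    hint.mono' hmeas.aestronglyMeasurable (ae_of_all _ fun ω => by
      rw [Real.norm_of_nonneg (Real.exp_pos _).le]; exact hle ω)
  refine ⟨hInt, (integral_mono hInt hint hle).trans ?_⟩
  rw [integral_finsetSum _ fun j _ => (hcls j).1.const_mul _]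
  simp_rw [integral_const_mul]
  calc ∑ j, q j * ∫ ω, Real.exp (t / q j * S j ω) ∂μ
      ≤ ∑ j, q j * Real.exp (8192 * n * χ * t ^ 2) := by
        gcongr with j
        refine (hcls j).2.trans (Real.exp_le_exp.2 ?_)
        have h0 := hq0 j
        have h1 : 1 ≤ 2 * χ * q j := by
          have := hq1 j
          rw [div_le_iff₀ (by positivity)] at this
          linarith
        have h2 : ((C j).card : ℝ) ≤ 4 * n * χ * q j ^ 2 := by
          calc ((C j).card : ℝ) ≤ 2 * n * q j := hqC j
            _ ≤ 2 * n * q j * (2 * χ * q j) := le_mul_of_one_le_right (by positivity) h1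
            _ = _ := by ring
        calc 2048 * ((C j).card : ℝ) * (t / q j) ^ 2
            ≤ 2048 * (4 * n * χ * q j ^ 2) * (t / q j) ^ 2 := by gcongr
          _ = _ := by field_simp; ring
    _ = _ := by rw [← Finset.sum_mul, hqs, one_mul]

theorem measureReal_abs_sum_sq_sub_one_ge_le [IsProbabilityMeasure μ] [Fintype κ] [Nonempty κ]
    (hξ : iIndepFun ξ μ)
    (hm : ∀ p, AEMeasurable (ξ p) μ) (w : κ → ι → ℝ)
    (hsub : ∀ i, HasSubgaussianMGF (fun ω => ∑ p, w i p * ξ p ω) 3 μ)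
    (hvar : ∀ i, ∫ ω, (∑ p, w i p * ξ p ω) ^ 2 ∂μ = 1)
    {χ : ℕ} (f : κ → Fin χ) (hd : ∀ i j, i ≠ j → f i = f j → ∀ p, w i p * w j p = 0)
    {ε : ℝ} (hε : 0 < ε) (hε1 : ε ≤ 1) :
    μ.real {ω | ε * Fintype.card κ ≤ |∑ i, ((∑ p, w i p * ξ p ω) ^ 2 - 1)|} ≤
      2 * Real.exp (-(ε ^ 2 / 32768 * (Fintype.card κ / χ))) := by
  have hχ : 0 < (χ : ℝ) := by
    have : 0 < χ := Fin.pos (f (Classical.arbitrary κ))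
    exact_mod_cast this
  set n : ℝ := (Fintype.card κ : ℝ) with hn
  set Z : Ω → ℝ := fun ω => ∑ i, ((∑ p, w i p * ξ p ω) ^ 2 - 1) with hZ
  -- The minimiser of `-t ε n + 8192 n χ t²`; `ε ≤ 1` puts it in the admissible range.
  set t : ℝ := ε / (16384 * χ) with ht
  have ht0 : 0 < t := by positivity
  have ht1 : |t| ≤ 1 / (32 * χ) := by
    rw [abs_of_pos ht0, ht, div_le_div_iff₀ (by positivity) (by positivity)]
    nlinarith
  have hpos := exp_sum_sq_sub_one_of_coloring hξ hm w hsub hvar f hd ht1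
  have hneg := exp_sum_sq_sub_one_of_coloring hξ hm w hsub hvar f hd (t := -t) (by rwa [abs_neg])
  have hexp : Real.exp (-t * (ε * n)) * Real.exp (8192 * n * χ * t ^ 2) =
      Real.exp (-(ε ^ 2 / 32768 * (n / χ))) := by
    rw [← Real.exp_add, ht]
    congr 1
    field_simp
    ring
  have h1 : μ.real {ω | ε * n ≤ Z ω} ≤ Real.exp (-(ε ^ 2 / 32768 * (n / χ))) := by
    rw [← hexp]
    refine (measure_ge_le_exp_mul_mgf _ ht0.le hpos.1).trans ?_
    gcongr
    exact hpos.2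
  have h2 : μ.real {ω | Z ω ≤ -(ε * n)} ≤ Real.exp (-(ε ^ 2 / 32768 * (n / χ))) := by
    rw [← hexp]
    refine (measure_le_le_exp_mul_mgf _ (neg_nonpos.2 ht0.le) hneg.1).trans ?_
    have : -(-t) * -(ε * n) = -t * (ε * n) := by ring
    rw [this]
    gcongr
    rw [← neg_sq t]
    exact hneg.2
  calc μ.real {ω | ε * n ≤ |Z ω|}
      ≤ μ.real ({ω | ε * n ≤ Z ω} ∪ {ω | Z ω ≤ -(ε * n)}) := by
        refine measureReal_mono fun ω hω => ?_
        simp only [Set.mem_ofPred_eq, Set.mem_union, le_abs] at hω ⊢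
        exact hω.imp id fun h => by linarith
    _ ≤ _ := (measureReal_union_le _ _).trans (by linarith)

end

/-! ### The three entry laws and their linear combinations. -/

theorem isProbabilityMeasure_signLaw (n : ℕ) : IsProbabilityMeasure (signLaw n) := by
  constructor
  simp only [signLaw, Measure.add_apply, Measure.smul_apply, measure_univ, smul_eq_mul, mul_one]
  rw [← ENNReal.ofReal_add (by norm_num) (by norm_num)]
  norm_num

theorem isProbabilityMeasure_sparseSignLaw (n : ℕ) : IsProbabilityMeasure (sparseSignLaw n) := by
  constructor
  simp only [sparseSignLaw, Measure.add_apply, Measure.smul_apply, measure_univ, smul_eq_mul,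
    mul_one]
  rw [← ENNReal.ofReal_add (by norm_num) (by norm_num),
    ← ENNReal.ofReal_add (by norm_num) (by norm_num)]
  norm_num

theorem integral_signLaw (n : ℕ) (f : ℝ → ℝ) :
    ∫ x, f x ∂(signLaw n) = 1 / 2 * f (1 / √(n : ℝ)) + 1 / 2 * f (-(1 / √(n : ℝ))) := by
  have hi : ∀ (c : ℝ) (a : ℝ), Integrable f (ENNReal.ofReal c • Measure.dirac a) := fun c a =>
    (integrable_dirac (by simp)).smul_measure (by simp)
  rw [signLaw, integral_add_measure (hi _ _) (hi _ _)]
  simp [integral_smul_measure]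

theorem integral_sparseSignLaw (n : ℕ) (f : ℝ → ℝ) :
    ∫ x, f x ∂(sparseSignLaw n) =
      1 / 6 * f √(3 / (n : ℝ)) + 2 / 3 * f 0 + 1 / 6 * f (-√(3 / (n : ℝ))) := by
  have hi : ∀ (c : ℝ) (a : ℝ), Integrable f (ENNReal.ofReal c • Measure.dirac a) := fun c a =>
    (integrable_dirac (by simp)).smul_measure (by simp)
  rw [sparseSignLaw, integral_add_measure ((hi _ _).add_measure (hi _ _)) (hi _ _),
    integral_add_measure (hi _ _) (hi _ _)]
  simp only [integral_smul_measure, integral_dirac, smul_eq_mul]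
  rw [ENNReal.toReal_ofReal (by norm_num), ENNReal.toReal_ofReal (by norm_num)]

/-- Hoeffding's lemma: an interval of length `2√3` gives parameter `(2√3/2)² = 3`. The sparse sign
law, rescaled, takes the extreme values `±√3`, which is why 3 is the common parameter. -/
theorem hasSubgaussianMGF_three_of_abs_le {Ω : Type*} [MeasurableSpace Ω] {μ : Measure Ω}
    [IsProbabilityMeasure μ] {X : Ω → ℝ} (hm : AEMeasurable X μ) (hb : ∀ᵐ ω ∂μ, |X ω| ≤ √3)
    (h0 : ∫ ω, X ω ∂μ = 0) : HasSubgaussianMGF X 3 μ := by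
  have h := hasSubgaussianMGF_of_mem_Icc_of_integral_eq_zero (a := -√3) (b := √3) hm
    (hb.mono fun ω hω => abs_le.1 hω) h0
  convert h
  ext
  push_cast
  rw [Real.norm_of_nonneg (by linarith [Real.sqrt_nonneg 3])]
  ring_nf
  norm_num

/-- A centred variable of unit variance with sub-Gaussian parameter `3`. -/
structure IsUnitSubgaussian {Ω : Type*} [MeasurableSpace Ω] (X : Ω → ℝ) (μ : Measure Ω) :
    Prop where
  subgaussian : HasSubgaussianMGF X 3 μ
  integral_eq_zero : ∫ ω, X ω ∂μ = 0
  integral_sq : ∫ ω, X ω ^ 2 ∂μ = 1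

theorem isUnitSubgaussian_signLaw {n : ℕ} (hn : 0 < n) :
    IsUnitSubgaussian (fun x => √(n : ℝ) * x) (signLaw n) := by
  have := isProbabilityMeasure_signLaw n
  have hs : √(n : ℝ) ≠ 0 := by positivity
  have h0 : ∫ x, √(n : ℝ) * x ∂(signLaw n) = 0 := by rw [integral_signLaw]; ring
  refine ⟨hasSubgaussianMGF_three_of_abs_le (by fun_prop) ?_ h0, h0, ?_⟩
  · rw [signLaw, ae_add_measure_iff]
    constructor <;> refine Measure.ae_smul_measure ?_ _ <;>
      rw [ae_dirac_iff (measurableSet_le (by fun_prop) (by fun_prop))] <;>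
      simp [hs]
  · rw [integral_signLaw]
    field_simp
    norm_num

theorem isUnitSubgaussian_sparseSignLaw {n : ℕ} (hn : 0 < n) :
    IsUnitSubgaussian (fun x => √(n : ℝ) * x) (sparseSignLaw n) := by
  have := isProbabilityMeasure_sparseSignLaw n
  have hs : √(n : ℝ) * √(3 / (n : ℝ)) = √3 := by
    rw [← Real.sqrt_mul (by positivity)]
    congr 1
    field_simp
  have h0 : ∫ x, √(n : ℝ) * x ∂(sparseSignLaw n) = 0 := by rw [integral_sparseSignLaw]; ring
  refine ⟨hasSubgaussianMGF_three_of_abs_le (by fun_prop) ?_ h0, h0, ?_⟩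
  · rw [sparseSignLaw, ae_add_measure_iff, ae_add_measure_iff]
    refine ⟨⟨?_, ?_⟩, ?_⟩ <;> refine Measure.ae_smul_measure ?_ _ <;>
      rw [ae_dirac_iff (measurableSet_le (by fun_prop) (by fun_prop))]
    · rw [hs, abs_of_nonneg (Real.sqrt_nonneg _)]
    · simp
    · rw [mul_neg, hs, abs_neg, abs_of_nonneg (Real.sqrt_nonneg _)]
  · rw [integral_sparseSignLaw, mul_neg, hs]
    ring_nf
    norm_num

theorem isUnitSubgaussian_gaussianReal {n : ℕ} (hn : 0 < n) :
    IsUnitSubgaussian (fun x => √(n : ℝ) * x) (gaussianReal 0 (1 / (n : NNReal))) := by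
  have hlaw : HasLaw (fun x => √(n : ℝ) * x) (gaussianReal 0 1)
      (gaussianReal 0 (1 / (n : NNReal))) := by
    have h := gaussianReal_const_mul (HasLaw.id (μ := gaussianReal 0 (1 / (n : NNReal)))) √(n : ℝ)
    convert h using 2
    · simp
    · simp
    · apply NNReal.coe_injective
      have : (n : ℝ) ≠ 0 := by positivity
      simp [this]
  have hsq : ∫ x, x ^ 2 ∂(gaussianReal 0 1) = 1 := by
    have h := variance_fun_id_gaussianReal (μ := 0) (v := 1)
    rw [variance_of_integral_eq_zero (by fun_prop) integral_id_gaussianReal] at h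
    simpa using h
  refine ⟨⟨fun t => ?_, fun t => ?_⟩, ?_, ?_⟩
  · have := integrable_exp_mul_gaussianReal (μ := 0) (v := 1 / (n : NNReal)) (t * √(n : ℝ))
    simpa only [mul_assoc] using this
  · rw [mgf_gaussianReal hlaw.map_eq]
    refine Real.exp_le_exp.2 ?_
    push_cast
    nlinarith [sq_nonneg t]
  · rw [integral_const_mul, integral_id_gaussianReal, mul_zero]
  · rw [← hsq]
    exact hlaw.integral_comp (f := fun x => x ^ 2) (by fun_prop)

theorem IsEntryLaw.isUnitSubgaussian {Ω : Type*} [MeasurableSpace Ω] {μ : Measure Ω} {n : ℕ}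
    (hn : 0 < n) {ν : Measure ℝ} (hν : IsEntryLaw n ν) {Y : Ω → ℝ} (hY : HasLaw Y ν μ) :
    IsUnitSubgaussian (fun ω => √(n : ℝ) * Y ω) μ := by
  have h : IsUnitSubgaussian (fun x => √(n : ℝ) * x) ν := by
    rcases hν with rfl | rfl | rfl
    exacts [isUnitSubgaussian_gaussianReal hn, isUnitSubgaussian_signLaw hn,
      isUnitSubgaussian_sparseSignLaw hn]
  refine ⟨?_, ?_, ?_⟩
  · exact HasSubgaussianMGF.of_map (X := fun x => √(n : ℝ) * x) hY.aemeasurable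
      (by rw [hY.map_eq]; exact h.subgaussian)
  · rw [← h.integral_eq_zero]
    exact hY.integral_comp (f := fun x => √(n : ℝ) * x) (by fun_prop)
  · rw [← h.integral_sq]
    exact hY.integral_comp (f := fun x => (√(n : ℝ) * x) ^ 2) (by fun_prop)

theorem IsUnitSubgaussian.sum_mul {Ω ι : Type*} [MeasurableSpace Ω] {μ : Measure Ω}
    [IsProbabilityMeasure μ] [Fintype ι] {ξ : ι → Ω → ℝ} (h : ∀ p, IsUnitSubgaussian (ξ p) μ)
    (hξ : iIndepFun ξ μ) {w : ι → ℝ} (hw : ∑ p, w p ^ 2 = 1) :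
    IsUnitSubgaussian (fun ω => ∑ p, w p * ξ p ω) μ := by
  have hind : iIndepFun (fun p ω => w p * ξ p ω) μ :=
    hξ.comp (fun p x => w p * x) fun p => by fun_prop
  have h1 := HasSubgaussianMGF.sum_of_iIndepFun hind (s := Finset.univ)
    (c := fun p => NNReal.mk (w p ^ 2) (sq_nonneg _) * 3) fun p _ => (h p).subgaussian.const_mul (w p)
  have hL : ∀ p, MemLp (fun ω => w p * ξ p ω) 2 μ := fun p =>
    (show MemLp (ξ p) 2 μ by simpa using (h p).subgaussian.memLp 2).const_mul _
  have h0 : ∫ ω, ∑ p, w p * ξ p ω ∂μ = 0 := by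
    rw [integral_finsetSum _ fun p _ => (h p).subgaussian.integrable.const_mul _]
    simp [integral_const_mul, (h _).integral_eq_zero]
  have hsub : HasSubgaussianMGF (fun ω => ∑ p, w p * ξ p ω) 3 μ := by
    convert h1
    apply NNReal.coe_injective
    push_cast
    rw [← Finset.sum_mul]
    simp [hw]
  refine ⟨hsub, h0, ?_⟩
  have hv := IndepFun.variance_sum (s := Finset.univ) (fun p _ => hL p)
    fun i _ j _ hij => hind.indepFun hij
  have hfun : (∑ p, fun ω => w p * ξ p ω) = fun ω => ∑ p, w p * ξ p ω := by
    ext ω; simp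
  rw [hfun, variance_of_integral_eq_zero hsub.aemeasurable h0] at hv
  rw [hv, ← hw]
  refine Finset.sum_congr rfl fun p _ => ?_
  rw [variance_const_mul, variance_of_integral_eq_zero (h p).subgaussian.aemeasurable
    (h p).integral_eq_zero, (h p).integral_sq, mul_one]

/-! ### Nets and near-isometries. -/

/-- The unit ball of a finite-dimensional normed space has a `1/2`-net of at most `5 ^ dim`
points. -/
theorem exists_half_net (E : Type*) [NormedAddCommGroup E] [NormedSpace ℝ E]
    [FiniteDimensional ℝ E] :
    ∃ S : Finset E, S.card ≤ 5 ^ Module.finrank ℝ E ∧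
      ∀ x : E, ‖x‖ ≤ 1 → ∃ y ∈ S, ‖x - y‖ ≤ 1 / 2 := by
  classical
  let P : Finset E → Prop := fun S =>
    -- A largest 1-separated subset of the ball of radius 2 will be scaled by `1/2`; a point it
    -- fails to cover could be added.
    (∀ c ∈ S, ‖c‖ ≤ 2) ∧ ∀ c ∈ S, ∀ d ∈ S, c ≠ d → 1 ≤ ‖c - d‖
  have hbdd : ∀ S, P S → S.card ≤ 5 ^ Module.finrank ℝ E := fun S hS =>
    Besicovitch.card_le_of_separated S hS.1 hS.2
  obtain ⟨S, hS, hmax⟩ : ∃ S, P S ∧ ∀ S', P S' → S'.card ≤ S.card := by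
    let Q : ℕ → Prop := fun k => ∃ S, P S ∧ S.card = k
    have hQ : Q 0 := ⟨∅, by simp [P], rfl⟩
    obtain ⟨S, hS, hc⟩ := Nat.findGreatest_spec (P := Q) (Nat.zero_le (5 ^ Module.finrank ℝ E)) hQ
    exact ⟨S, hS, fun S' hS' => hc ▸ Nat.le_findGreatest (hbdd S' hS') ⟨S', hS', rfl⟩⟩
  refine ⟨S.image fun x => (1 / 2 : ℝ) • x, Finset.card_image_le.trans (hbdd S hS),
    fun x hx => ?_⟩
  by_contra! hcon
  have hfar : ∀ c ∈ S, 1 ≤ ‖(2 : ℝ) • x - c‖ := fun c hc => by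
    have h := hcon ((1 / 2 : ℝ) • c) (Finset.mem_image_of_mem _ hc)
    have h2 : (2 : ℝ) • x - c = (2 : ℝ) • (x - (1 / 2 : ℝ) • c) := by
      rw [smul_sub, smul_smul]; norm_num
    rw [h2, norm_smul, Real.norm_ofNat]
    linarith
  have hnot : (2 : ℝ) • x ∉ S := fun hmem => by
    have := hfar _ hmem
    norm_num at this
  have := hmax (insert ((2 : ℝ) • x) S) ⟨fun c hc => ?_, fun c hc d hd hne => ?_⟩
  · rw [Finset.card_insert_of_notMem hnot] at this
    omega
  · rcases Finset.mem_insert.1 hc with rfl | hc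
    · rw [norm_smul, Real.norm_ofNat]; linarith
    · exact hS.1 c hc
  · rcases Finset.mem_insert.1 hc with rfl | hc <;> rcases Finset.mem_insert.1 hd with rfl | hd
    · exact absurd rfl hne
    · exact hfar d hd
    · rw [norm_sub_rev]; exact hfar c hc
    · exact hS.2 c hc d hd hne

/-- The unit ball of a finite-dimensional normed space has a `1/4`-net of at most `25 ^ dim`
points. -/
theorem exists_quarter_net (E : Type*) [NormedAddCommGroup E] [NormedSpace ℝ E]
    [FiniteDimensional ℝ E] :
    ∃ S : Finset E, S.card ≤ 25 ^ Module.finrank ℝ E ∧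
      ∀ x : E, ‖x‖ ≤ 1 → ∃ y ∈ S, ‖x - y‖ ≤ 1 / 4 := by
  classical
  obtain ⟨S, hS, hnet⟩ := exists_half_net E
  -- The `1/2`-net is used twice: for `x`, then for the doubled error `2(x - y)`, again in the unit
  -- ball.
  refine ⟨(S ×ˢ S).image fun p => p.1 + (1 / 2 : ℝ) • p.2, ?_, fun x hx => ?_⟩
  · refine Finset.card_image_le.trans ?_
    rw [Finset.card_product, show (25 : ℕ) = 5 * 5 by norm_num, mul_pow]
    exact Nat.mul_le_mul hS hS
  · obtain ⟨y, hy, hxy⟩ := hnet x hx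
    obtain ⟨z, hz, hxz⟩ := hnet ((2 : ℝ) • (x - y)) (by
      rw [norm_smul, Real.norm_ofNat]; linarith)
    refine ⟨y + (1 / 2 : ℝ) • z, Finset.mem_image.2 ⟨(y, z), by simp [hy, hz], rfl⟩, ?_⟩
    have : x - (y + (1 / 2 : ℝ) • z) = (1 / 2 : ℝ) • ((2 : ℝ) • (x - y) - z) := by
      rw [smul_sub, smul_smul]; norm_num; abel
    rw [this, norm_smul, Real.norm_of_nonneg (by norm_num)]
    linarith

section

variable {E F : Type*} [NormedAddCommGroup E] [InnerProductSpace ℝ E]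
  [NormedAddCommGroup F] [InnerProductSpace ℝ F]

/-- Polarisation with `u + v` and `u - v`, followed by the parallelogram identity. -/
theorem abs_inner_map_sub_inner_le (A : E →ₗ[ℝ] F) {M : ℝ}
    (hM : ∀ x, |‖A x‖ ^ 2 - ‖x‖ ^ 2| ≤ M * ‖x‖ ^ 2) (u v : E) :
    |inner ℝ (A u) (A v) - inner ℝ u v| ≤ M * (‖u‖ ^ 2 + ‖v‖ ^ 2) / 2 := by
  have h1 := abs_le.1 (hM (u + v))
  have h2 := abs_le.1 (hM (u - v))
  have e1 := norm_add_sq_real u v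
  have e2 := norm_sub_sq_real u v
  have e3 := norm_add_sq_real (A u) (A v)
  have e4 := norm_sub_sq_real (A u) (A v)
  rw [map_add] at h1
  rw [map_sub] at h2
  rw [e1, e3] at h1
  rw [e2, e4] at h2
  rw [abs_le]
  constructor <;> linarith [h1.1, h1.2, h2.1, h2.2]

/-- A linear map which is a near-isometry on a `1/4`-net of the unit ball is a near-isometry. -/
theorem abs_sq_norm_sub_sq_norm_le_of_net [FiniteDimensional ℝ E] (A : E →ₗ[ℝ] F) (S : Finset E)
    (hS : ∀ x : E, ‖x‖ ≤ 1 → ∃ y ∈ S, ‖x - y‖ ≤ 1 / 4) {δ : ℝ} (hδ : 0 ≤ δ)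
    (hA : ∀ y ∈ S, |‖A y‖ ^ 2 - ‖y‖ ^ 2| ≤ δ / 4 * ‖y‖ ^ 2) (x : E) :
    |‖A x‖ ^ 2 - ‖x‖ ^ 2| ≤ δ * ‖x‖ ^ 2 := by
  -- Any admissible constant `M` improves to `3/7 δ + 4/7 M`, a contraction with fixed point `δ`.
  -- The least admissible constant is therefore at most `δ`.
  let K : Set ℝ := {M | 0 ≤ M ∧ ∀ x, |‖A x‖ ^ 2 - ‖x‖ ^ 2| ≤ M * ‖x‖ ^ 2}
  have hstep : ∀ M ∈ K, 3 / 7 * δ + 4 / 7 * M ∈ K := by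
    rintro M ⟨hM0, hM⟩
    refine ⟨by positivity, fun x => ?_⟩
    have hunit : ∀ x : E, ‖x‖ = 1 → |‖A x‖ ^ 2 - ‖x‖ ^ 2| ≤ 3 / 7 * δ + 4 / 7 * M := by
      intro x hx
      obtain ⟨y, hy, hxy⟩ := hS x hx.le
      have hyn : ‖y‖ ≤ 5 / 4 := by
        have := norm_sub_norm_le y x
        rw [norm_sub_rev] at this
        linarith
      have hsn : ‖x + y‖ ≤ 9 / 4 := (norm_add_le x y).trans (by linarith)
      -- The defects at `x` and `y` differ by the bilinear defect at `(x - y, x + y)`. The factors 3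
      -- and `1/3` leave it unchanged and bring both norms below `3/4`, so it is at most `9/16 M ≤
      -- 4/7 M`; the net contributes `25/64 δ ≤ 3/7 δ`.
      have hB := abs_inner_map_sub_inner_le A hM ((3 : ℝ) • (x - y)) ((1 / 3 : ℝ) • (x + y))
      rw [map_smul, map_smul, real_inner_smul_left, real_inner_smul_right, real_inner_smul_left,
        real_inner_smul_right, map_sub, map_add] at hB
      have e1 : inner ℝ (A x - A y) (A x + A y) = ‖A x‖ ^ 2 - ‖A y‖ ^ 2 := by
        rw [inner_sub_left, inner_add_right, inner_add_right, real_inner_self_eq_norm_sq,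
          real_inner_self_eq_norm_sq, real_inner_comm]; ring
      have e2 : inner ℝ (x - y) (x + y) = ‖x‖ ^ 2 - ‖y‖ ^ 2 := by
        rw [inner_sub_left, inner_add_right, inner_add_right, real_inner_self_eq_norm_sq,
          real_inner_self_eq_norm_sq, real_inner_comm]; ring
      rw [e1, e2, norm_smul, norm_smul, Real.norm_ofNat, Real.norm_of_nonneg (by norm_num)] at hB
      have h3 : (3 * ‖x - y‖) ^ 2 ≤ 9 / 16 := by nlinarith [norm_nonneg (x - y)]
      have h4 : (1 / 3 * ‖x + y‖) ^ 2 ≤ 9 / 16 := by nlinarith [norm_nonneg (x + y)]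
      have h5 : M * ((3 * ‖x - y‖) ^ 2 + (1 / 3 * ‖x + y‖) ^ 2) / 2 ≤ M * (9 / 16) := by
        nlinarith
      have h6 := hA y hy
      have h7 : δ / 4 * ‖y‖ ^ 2 ≤ δ / 4 * (25 / 16) := by
        gcongr; nlinarith [norm_nonneg y]
      rw [abs_le] at hB h6 ⊢
      constructor <;> linarith [hB.1, hB.2, h6.1, h6.2]
    rcases eq_or_ne x 0 with rfl | hx
    · simp
    · have hx0 : 0 < ‖x‖ := norm_pos_iff.2 hx
      have h := hunit (‖x‖⁻¹ • x) (by rw [norm_smul]; simp [hx])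
      rw [map_smul, norm_smul, norm_smul, mul_pow, mul_pow, ← mul_sub, abs_mul,
        abs_of_nonneg (by positivity), norm_inv, norm_norm, inv_pow,
        inv_mul_le_iff₀ (by positivity)] at h
      linarith
  have hne : K.Nonempty := by
    refine ⟨‖LinearMap.toContinuousLinearMap A‖ ^ 2 + 1, by positivity, fun x => ?_⟩
    have h1 : ‖A x‖ ≤ ‖LinearMap.toContinuousLinearMap A‖ * ‖x‖ :=
      (LinearMap.toContinuousLinearMap A).le_opNorm x
    have h2 : ‖A x‖ ^ 2 ≤ ‖LinearMap.toContinuousLinearMap A‖ ^ 2 * ‖x‖ ^ 2 := by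
      rw [← mul_pow]; gcongr
    have h3 : 0 ≤ ‖LinearMap.toContinuousLinearMap A‖ ^ 2 * ‖x‖ ^ 2 := by positivity
    rw [abs_le]
    constructor <;> nlinarith [sq_nonneg ‖A x‖, sq_nonneg ‖x‖]
  have hbdd : BddBelow K := ⟨0, fun M hM => hM.1⟩
  have hinf : ∀ x, |‖A x‖ ^ 2 - ‖x‖ ^ 2| ≤ sInf K * ‖x‖ ^ 2 := by
    intro x
    rcases eq_or_ne x 0 with rfl | hx
    · simp
    · have hx0 : 0 < ‖x‖ ^ 2 := by positivity
      rw [← div_le_iff₀ hx0]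
      exact le_csInf hne fun M hM => (div_le_iff₀ hx0).2 (hM.2 x)
  have hmem : sInf K ∈ K := ⟨Real.sInf_nonneg fun M hM => hM.1, hinf⟩
  have hle : sInf K ≤ δ := by
    have := csInf_le hbdd (hstep _ hmem)
    linarith
  exact (hinf x).trans (by gcongr)

end

/-! ### Counting supports and greedy colouring. -/

/-- The number of subsets of size at most `s` of an `N`-element set is at most `(eN/s)^s`. -/
theorem card_filter_card_le (V : Type*) [Fintype V] [DecidableEq V] {s : ℕ} (hs : 0 < s)
    (hsV : s ≤ Fintype.card V) :
    (((Finset.univ : Finset (Finset V)).filter fun T => T.card ≤ s).card : ℝ) ≤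
      (Real.exp 1 * (Fintype.card V / s)) ^ s := by
  set N := Fintype.card V with hN
  have hs' : (0 : ℝ) < s := by exact_mod_cast hs
  have hN' : (0 : ℝ) < N := by exact_mod_cast hs.trans_le hsV
  have hq : 1 ≤ (N : ℝ) / s := by rw [one_le_div hs']; exact_mod_cast hsV
  -- Weighted counting: multiplied by `(N/s)^s`, every set with at most `s` elements has weight at
  -- least 1, while the total weight factorises.
  have hsum : ∑ T : Finset V, ((s : ℝ) / N) ^ T.card = (1 + s / N) ^ N := by
    have := Finset.prod_one_add (f := fun _ : V => (s : ℝ) / N) (Finset.univ)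
    simpa [hN, div_pow] using this.symm
  calc (((Finset.univ : Finset (Finset V)).filter fun T => T.card ≤ s).card : ℝ)
      = ∑ T ∈ (Finset.univ : Finset (Finset V)).filter (fun T => T.card ≤ s), (1 : ℝ) := by simp
    _ ≤ ∑ T ∈ (Finset.univ : Finset (Finset V)).filter (fun T => T.card ≤ s),
          ((N : ℝ) / s) ^ s * ((s : ℝ) / N) ^ T.card := by
        refine Finset.sum_le_sum fun T hT => ?_
        have hT' : T.card ≤ s := (Finset.mem_filter.1 hT).2
        have e : ((N : ℝ) / s) ^ s * ((s : ℝ) / N) ^ T.card = ((N : ℝ) / s) ^ (s - T.card) := by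
          rw [← inv_div (N : ℝ) s, inv_pow, pow_sub₀ _ (by positivity) hT']
        rw [e]
        exact one_le_pow₀ hq
    _ ≤ ∑ T : Finset V, ((N : ℝ) / s) ^ s * ((s : ℝ) / N) ^ T.card :=
        Finset.sum_le_sum_of_subset_of_nonneg (Finset.filter_subset _ _) fun _ _ _ => by positivity
    _ = ((N : ℝ) / s) ^ s * (1 + s / N) ^ N := by rw [← Finset.mul_sum, hsum]
    _ ≤ ((N : ℝ) / s) ^ s * Real.exp (s / N) ^ N := by
        gcongr
        rw [add_comm]
        exact Real.add_one_le_exp _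
    _ = _ := by
        rw [← Real.exp_nat_mul, mul_pow, ← Real.exp_nat_mul, mul_comm]
        congr 2
        field_simp

/-- Greedy colouring of a symmetric relation of bounded degree. -/
theorem exists_greedy_coloring {V : Type*} [Fintype V] [DecidableEq V] (R : V → V → Prop)
    [DecidableRel R] (hsymm : ∀ x y, R x y → R y x) {D : ℕ}
    (hdeg : ∀ x, ((Finset.univ : Finset V).filter fun y => y ≠ x ∧ R x y).card ≤ D) :
    ∃ f : V → Fin (D + 1), ∀ x y, x ≠ y → R x y → f x ≠ f y := by
  suffices ∀ s : Finset V, ∃ f : V → Fin (D + 1), ∀ x ∈ s, ∀ y ∈ s, x ≠ y → R x y → f x ≠ f y by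
    obtain ⟨f, hf⟩ := this Finset.univ
    exact ⟨f, fun x y => hf x (Finset.mem_univ _) y (Finset.mem_univ _)⟩
  intro s
  induction s using Finset.induction_on with
  | empty => exact ⟨fun _ => 0, by simp⟩
  | insert a s ha ih =>
    obtain ⟨f, hf⟩ := ih
    obtain ⟨c, hc⟩ : ∃ c, c ∉ ((Finset.univ : Finset V).filter fun y => y ≠ a ∧ R a y).image f := by
      by_contra! hall
      have h1 : (Finset.univ : Finset (Fin (D + 1))).card ≤ D :=
        (Finset.card_le_card fun c _ => hall c).trans (Finset.card_image_le.trans (hdeg a))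
      simp at h1
    have hc' : ∀ y, y ≠ a → R a y → c ≠ f y := fun y hy hR h =>
      hc (Finset.mem_image.2 ⟨y, by simp [hy, hR], h.symm⟩)
    refine ⟨Function.update f a c, fun x hx y hy hne hR => ?_⟩
    rcases Finset.mem_insert.1 hx with rfl | hx' <;> rcases Finset.mem_insert.1 hy with rfl | hy'
    · exact absurd rfl hne
    · rw [Function.update_self, Function.update_of_ne hne.symm]
      exact hc' y hne.symm hR
    · rw [Function.update_self, Function.update_of_ne hne]
      exact (hc' x hne (hsymm _ _ hR)).symm
    · rw [Function.update_of_ne (by rintro rfl; exact ha hx'),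
        Function.update_of_ne (by rintro rfl; exact ha hy')]
      exact hf x hx' y hy' hne hR

/-! ### Repeated entries and row colourings of the circulant block matrix. -/

/-- The index of the block entry found in row `i` and column `t` of `circulantBlock l k B`. -/
def entryIndex {l k d e : ℕ} (i : Fin l × Fin d) (t : Fin k × Fin e) : ZMod k × Fin d × Fin e :=
  (((i.1 : ℕ) : ZMod k) - ((t.1 : ℕ) : ZMod k), i.2, t.2)

theorem ZMod.natCast_fin_injective {l k : ℕ} (hlk : l ≤ k) :
    Function.Injective fun r : Fin l => ((r : ℕ) : ZMod k) := fun r r' h => by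
  rw [ZMod.natCast_eq_natCast_iff', Nat.mod_eq_of_lt (r.2.trans_le hlk),
    Nat.mod_eq_of_lt (r'.2.trans_le hlk)] at h
  exact Fin.ext h

theorem entryIndex_injective {l k d e : ℕ} (i : Fin l × Fin d) :
    Function.Injective (entryIndex (k := k) (e := e) i) := by
  rintro ⟨c, b⟩ ⟨c', b'⟩ h
  simp only [entryIndex, Prod.mk.injEq, sub_right_inj, true_and] at h
  exact Prod.ext (ZMod.natCast_fin_injective le_rfl h.1) h.2

/-- A colouring of the rows such that the rows of one colour have no common entry in the
columns `T`. -/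
def IsRowColoring {l k d e χ : ℕ} (T : Finset (Fin k × Fin e)) (f : Fin l × Fin d → Fin χ) :
    Prop :=
  ∀ i j, i ≠ j → f i = f j → ∀ t ∈ T, ∀ t' ∈ T, entryIndex i t ≠ entryIndex j t'

/-- An entry remembers its row inside the block, so distinct rows of one block row never share an
entry. -/
theorem isRowColoring_fst {l k d e : ℕ} (T : Finset (Fin k × Fin e)) :
    IsRowColoring T (Prod.fst : Fin l × Fin d → Fin l) := by
  rintro ⟨r, a⟩ ⟨r', a'⟩ hne hr t _ t' _ h
  simp only [entryIndex, Prod.mk.injEq] at h hr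
  exact hne (Prod.ext hr h.2.1)

/-- If block rows `r ≠ r'` share an entry through columns `t, t'` of `T`, then `r'` is determined
modulo `k`, hence by `l ≤ k` outright, by `r` and the pair `(t, t')`; moreover `t ≠ t'`. So a block
row has at most `s(s-1)` conflicts, and greedy colouring needs one more colour. -/
theorem exists_isRowColoring {l k e : ℕ} (d : ℕ) (hlk : l ≤ k) {s : ℕ}
    (T : Finset (Fin k × Fin e)) (hT : T.card ≤ s) :
    ∃ f : Fin l × Fin d → Fin (s * (s - 1) + 1), IsRowColoring T f := by
  classical
  let R : Fin l → Fin l → Prop := fun r r' => ∃ t ∈ T, ∃ t' ∈ T, t.2 = t'.2 ∧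
    ((r : ℕ) : ZMod k) - ((t.1 : ℕ) : ZMod k) = ((r' : ℕ) : ZMod k) - ((t'.1 : ℕ) : ZMod k)
  have hdeg : ∀ r, ((Finset.univ : Finset (Fin l)).filter fun y => y ≠ r ∧ R r y).card
      ≤ s * (s - 1) := by
    intro r
    have h1 : ((Finset.univ : Finset (Fin l)).filter fun y => y ≠ r ∧ R r y).card ≤
        (T.offDiag.image fun q => ((r : ℕ) : ZMod k) - ((q.1.1 : ℕ) : ZMod k) +
          ((q.2.1 : ℕ) : ZMod k)).card := by
      refine Finset.card_le_card_of_injOn (fun y => ((y : ℕ) : ZMod k)) (fun y hy => ?_)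
        (ZMod.natCast_fin_injective hlk).injOn
      obtain ⟨hyr, t, ht, t', ht', h2, h⟩ := (Finset.mem_filter.1 hy).2
      refine Finset.mem_coe.2 (Finset.mem_image.2 ⟨(t, t'), Finset.mem_offDiag.2 ⟨ht, ht', ?_⟩, ?_⟩)
      · intro htt
        obtain rfl : t = t' := htt
        exact hyr (ZMod.natCast_fin_injective hlk (sub_left_injective h)).symm
      · simp [h]
    refine h1.trans (Finset.card_image_le.trans ?_)
    rw [Finset.offDiag_card, ← Nat.mul_sub_one]
    gcongr
  obtain ⟨g, hg⟩ := exists_greedy_coloring R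
    (fun r r' ⟨t, ht, t', ht', h2, h⟩ => ⟨t', ht', t, ht, h2.symm, h.symm⟩) hdeg
  refine ⟨fun i => g i.1, ?_⟩
  rintro ⟨r, a⟩ ⟨r', a'⟩ hne hr t ht t' ht' h
  simp only [entryIndex, Prod.mk.injEq] at h hr
  obtain ⟨h1, rfl, h3⟩ := h
  exact hg r r' (fun hrr => hne (by rw [hrr])) ⟨t, ht, t', ht', h3, h1⟩ hr

/-! ### Concentration for a fixed vector and the union bound. -/

section

variable {l k d e : ℕ} {Ω : Type*} [MeasurableSpace Ω] {μ : Measure Ω} [IsProbabilityMeasure μ]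
  {B : Ω → ZMod k → Matrix (Fin d) (Fin e) ℝ} {ν : Measure ℝ}

theorem sq_norm_circulantBlock_mulVec (b : ZMod k → Matrix (Fin d) (Fin e) ℝ)
    (T : Finset (Fin k × Fin e)) (z : EuclideanSpace ℝ T) :
    ‖WithLp.toLp 2 (((circulantBlock l k b).submatrix id
      (fun t : T => (t : Fin k × Fin e))).mulVec z.ofLp)‖ ^ 2 =
      ∑ i : Fin l × Fin d, (∑ t : T, b (entryIndex i (t : Fin k × Fin e)).1
        (entryIndex i (t : Fin k × Fin e)).2.1 (entryIndex i (t : Fin k × Fin e)).2.2 * z t) ^ 2 := by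
  rw [EuclideanSpace.real_norm_sq_eq]
  rfl

/-- Concentration of `‖A_T z‖²` for a fixed vector `z`. -/
theorem measureReal_not_near_isometry_le [NeZero k] (hn : 0 < l * d)
    (hν : IsEntryLaw (l * d) ν)
    (hind : iIndepFun (fun (p : ZMod k × Fin d × Fin e) (ω : Ω) => B ω p.1 p.2.1 p.2.2) μ)
    (hlaw : ∀ (i : ZMod k) (a : Fin d) (b : Fin e), HasLaw (fun ω => B ω i a b) ν μ)
    (T : Finset (Fin k × Fin e)) {χ : ℕ} (f : Fin l × Fin d → Fin χ) (hf : IsRowColoring T f)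
    (z : EuclideanSpace ℝ T) {ε : ℝ} (hε : 0 < ε) (hε1 : ε ≤ 1) :
    μ.real {ω | ¬ |‖WithLp.toLp 2 (((circulantBlock l k (B ω)).submatrix id
      (fun t : T => (t : Fin k × Fin e))).mulVec z.ofLp)‖ ^ 2 - ‖z‖ ^ 2| ≤ ε * ‖z‖ ^ 2} ≤
      2 * Real.exp (-(ε ^ 2 / 32768 * ((l * d : ℕ) / χ))) := by
  classical
  rcases eq_or_ne z 0 with rfl | hz
  · have : ∀ A : Matrix (Fin l × Fin d) T ℝ,
        A.mulVec (0 : EuclideanSpace ℝ T).ofLp = 0 := fun A => by simp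
    simp only [this]
    simp
    positivity
  have hz0 : 0 < ‖z‖ := norm_pos_iff.2 hz
  have hn' : (0 : ℝ) < (l * d : ℕ) := by exact_mod_cast hn
  have hcard : Fintype.card (Fin l × Fin d) = l * d := by simp
  have : Nonempty (Fin l × Fin d) := Fintype.card_pos_iff.1 (by omega)
  let ξ : ZMod k × Fin d × Fin e → Ω → ℝ := fun p ω => √((l * d : ℕ) : ℝ) * B ω p.1 p.2.1 p.2.2
  -- The unit vector `z/‖z‖` transported to the entries read by row `i`. No entry occurs twice in a
  -- row, so the norm stays 1.
  let w : Fin l × Fin d → ZMod k × Fin d × Fin e → ℝ := fun i p =>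
    ∑ t : T, if entryIndex i (t : Fin k × Fin e) = p then z t / ‖z‖ else 0
  have hw : ∀ i (g : ZMod k × Fin d × Fin e → ℝ),
      ∑ p, w i p * g p = ∑ t : T, z t / ‖z‖ * g (entryIndex i (t : Fin k × Fin e)) := by
    intro i g
    simp only [w, Finset.sum_mul]
    rw [Finset.sum_comm]
    refine Finset.sum_congr rfl fun t _ => ?_
    simp [ite_mul]
  have hwi : ∀ i (t : T), w i (entryIndex i (t : Fin k × Fin e)) = z t / ‖z‖ := by
    intro i t
    simp only [w]
    rw [Finset.sum_eq_single t]
    · simp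
    · intro t' _ hne
      rw [if_neg fun h => hne (Subtype.ext (entryIndex_injective i h))]
    · simp
  have hw1 : ∀ i, ∑ p, w i p ^ 2 = 1 := by
    intro i
    simp_rw [sq]
    rw [hw]
    simp_rw [hwi, ← sq, div_pow]
    rw [← Finset.sum_div, ← EuclideanSpace.real_norm_sq_eq]
    exact div_self (by positivity)
  have hd : ∀ i j, i ≠ j → f i = f j → ∀ p, w i p * w j p = 0 := by
    intro i j hij hfij p
    by_contra hne
    obtain ⟨h1, h2⟩ := mul_ne_zero_iff.1 hne
    obtain ⟨t, _, ht⟩ := Finset.exists_ne_zero_of_sum_ne_zero h1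
    obtain ⟨t', _, ht'⟩ := Finset.exists_ne_zero_of_sum_ne_zero h2
    have e1 : entryIndex i (t : Fin k × Fin e) = p := by
      by_contra h; exact ht (if_neg h)
    have e2 : entryIndex j (t' : Fin k × Fin e) = p := by
      by_contra h; exact ht' (if_neg h)
    exact hf i j hij hfij t t.2 t' t'.2 (e1.trans e2.symm)
  have hunit : ∀ p, IsUnitSubgaussian (ξ p) μ := fun p =>
    hν.isUnitSubgaussian hn (hlaw p.1 p.2.1 p.2.2)
  have hξ : iIndepFun ξ μ :=
    hind.comp (fun _ x => √((l * d : ℕ) : ℝ) * x) fun _ => by fun_prop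
  have hrow := fun i => IsUnitSubgaussian.sum_mul hunit hξ (hw1 i)
  have key := measureReal_abs_sum_sq_sub_one_ge_le hξ
    (fun p => (hunit p).subgaussian.aemeasurable) w (fun i => (hrow i).subgaussian)
    (fun i => (hrow i).integral_sq) f hd hε hε1
  rw [hcard] at key
  refine le_trans (measureReal_mono fun ω hω => ?_) key
  have hsum : ∑ i, ((∑ p, w i p * ξ p ω) ^ 2 - 1) = (l * d : ℕ) / ‖z‖ ^ 2 *
      (‖WithLp.toLp 2 (((circulantBlock l k (B ω)).submatrix id
        (fun t : T => (t : Fin k × Fin e))).mulVec z.ofLp)‖ ^ 2 - ‖z‖ ^ 2) := by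
    rw [Finset.sum_sub_distrib, mul_sub, div_mul_cancel₀ _ (by positivity),
      sq_norm_circulantBlock_mulVec, Finset.mul_sum]
    congr 1
    · refine Finset.sum_congr rfl fun i _ => ?_
      have : ∑ p, w i p * ξ p ω = √((l * d : ℕ) : ℝ) / ‖z‖ *
          ∑ t : T, B ω (entryIndex i (t : Fin k × Fin e)).1
            (entryIndex i (t : Fin k × Fin e)).2.1
            (entryIndex i (t : Fin k × Fin e)).2.2 * z t := by
        rw [hw i fun p => ξ p ω, Finset.mul_sum]
        refine Finset.sum_congr rfl fun t _ => ?_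
        simp only [ξ]
        ring
      rw [this, mul_pow, div_pow, Real.sq_sqrt hn'.le]
    · simp
  simp only [Set.mem_ofPred_eq, not_le] at hω ⊢
  rw [hsum, abs_mul, abs_of_pos (by positivity)]
  calc ε * ((l * d : ℕ) : ℝ) = (l * d : ℕ) / ‖z‖ ^ 2 * (ε * ‖z‖ ^ 2) := by field_simp
    _ ≤ _ := by gcongr

theorem satisfiesRIP_of_abs_le {ι κ : Type*} [Fintype ι] {A : Matrix ι κ ℝ} {s : ℕ} {δ : ℝ}
    (h : ∀ T : Finset κ, T.card ≤ s → ∀ z : EuclideanSpace ℝ T,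
      |‖WithLp.toLp 2 ((A.submatrix id (fun t : T => (t : κ))).mulVec z.ofLp)‖ ^ 2 - ‖z‖ ^ 2| ≤
        δ * ‖z‖ ^ 2) : SatisfiesRIP A s δ := fun T hT z => by
  have := abs_le.1 (h T hT z)
  constructor <;> linarith [this.1, this.2]

/-- The three factors count the supports, the net points per support, and the failure probability at
one net point. Accuracy `δ/4` on the net turns 32768 into `16 * 32768 = 524288`. -/
theorem measureReal_not_satisfiesRIP_le [NeZero k] (hn : 0 < l * d)
    (hν : IsEntryLaw (l * d) ν)
    (hind : iIndepFun (fun (p : ZMod k × Fin d × Fin e) (ω : Ω) => B ω p.1 p.2.1 p.2.2) μ)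
    (hlaw : ∀ (i : ZMod k) (a : Fin d) (b : Fin e), HasLaw (fun ω => B ω i a b) ν μ)
    {s χ : ℕ} (hs : 0 < s) (hsN : s ≤ k * e)
    (hcol : ∀ T : Finset (Fin k × Fin e), T.card ≤ s →
      ∃ f : Fin l × Fin d → Fin χ, IsRowColoring T f)
    {δ : ℝ} (hδ : 0 < δ) (hδ1 : δ ≤ 1) :
    μ.real {ω | ¬ SatisfiesRIP (circulantBlock l k (B ω)) s δ} ≤
      (Real.exp 1 * ((k * e : ℕ) / s)) ^ s *
        (25 ^ s * (2 * Real.exp (-(δ ^ 2 / 524288 * ((l * d : ℕ) / χ))))) := by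
  classical
  have hnet := fun T : Finset (Fin k × Fin e) => exists_quarter_net (EuclideanSpace ℝ T)
  choose S hScard hS using hnet
  let bad : (T : Finset (Fin k × Fin e)) → EuclideanSpace ℝ T → Set Ω := fun T z =>
    {ω | ¬ |‖WithLp.toLp 2 (((circulantBlock l k (B ω)).submatrix id
      (fun t : T => (t : Fin k × Fin e))).mulVec z.ofLp)‖ ^ 2 - ‖z‖ ^ 2| ≤ δ / 4 * ‖z‖ ^ 2}
  let 𝒯 : Finset (Finset (Fin k × Fin e)) := Finset.univ.filter fun T => T.card ≤ s
  have hsub : {ω | ¬ SatisfiesRIP (circulantBlock l k (B ω)) s δ} ⊆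
      ⋃ T ∈ 𝒯, ⋃ z ∈ S T, bad T z := by
    intro ω hω
    by_contra hcon
    simp only [Set.mem_iUnion, not_exists] at hcon
    refine hω (satisfiesRIP_of_abs_le fun T hT z => ?_)
    refine abs_sq_norm_sub_sq_norm_le_of_net
      ((WithLp.linearEquiv 2 ℝ (Fin l × Fin d → ℝ)).symm.toLinearMap ∘ₗ
        ((circulantBlock l k (B ω)).submatrix id
          (fun t : T => (t : Fin k × Fin e))).mulVecLin ∘ₗ
        (WithLp.linearEquiv 2 ℝ (T → ℝ)).toLinearMap : EuclideanSpace ℝ T →ₗ[ℝ]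
          EuclideanSpace ℝ (Fin l × Fin d)) (S T) (hS T) hδ.le (fun y hy => ?_) z
    have := hcon T (by simp [𝒯, hT]) y hy
    exact not_not.1 this
  have hbad : ∀ T ∈ 𝒯, ∀ z ∈ S T,
      μ.real (bad T z) ≤ 2 * Real.exp (-(δ ^ 2 / 524288 * ((l * d : ℕ) / χ))) := by
    intro T hT z _
    obtain ⟨f, hf⟩ := hcol T (Finset.mem_filter.1 hT).2
    have := measureReal_not_near_isometry_le hn hν hind hlaw T f hf z (ε := δ / 4)
      (by positivity) (by linarith)
    rwa [show (δ / 4) ^ 2 / 32768 = δ ^ 2 / 524288 by ring] at this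
  set β : ℝ := 2 * Real.exp (-(δ ^ 2 / 524288 * ((l * d : ℕ) / χ))) with hβ
  have hβ0 : 0 ≤ β := by positivity
  calc μ.real {ω | ¬ SatisfiesRIP (circulantBlock l k (B ω)) s δ}
      ≤ μ.real (⋃ T ∈ 𝒯, ⋃ z ∈ S T, bad T z) := measureReal_mono hsub (measure_ne_top _ _)
    _ ≤ ∑ T ∈ 𝒯, μ.real (⋃ z ∈ S T, bad T z) := measureReal_biUnion_finset_le _ _
    _ ≤ ∑ T ∈ 𝒯, 25 ^ s * β := by
        refine Finset.sum_le_sum fun T hT => ?_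
        calc μ.real (⋃ z ∈ S T, bad T z) ≤ ∑ z ∈ S T, μ.real (bad T z) :=
              measureReal_biUnion_finset_le _ _
          _ ≤ ∑ z ∈ S T, β := Finset.sum_le_sum fun z hz => hbad T hT z hz
          _ = (S T).card * β := by simp
          _ ≤ 25 ^ s * β := by
              gcongr
              have h1 := hScard T
              rw [finrank_euclideanSpace, Fintype.card_coe] at h1
              have h2 : 25 ^ T.card ≤ 25 ^ s :=
                Nat.pow_le_pow_right (by norm_num) (Finset.mem_filter.1 hT).2
              exact_mod_cast h1.trans h2
    _ = (𝒯.card : ℝ) * (25 ^ s * β) := by simp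
    _ ≤ _ := by
        gcongr
        have := card_filter_card_le (Fin k × Fin e) hs (by simpa using hsN)
        simpa using this

end

/-! ### Choice of constants and conclusion. -/

/-- Put `L = ln(N/m)`, which is at least 1 because `N/m ≥ 3 > e`. The supports, the nets and the
factor 2 cost exponents `3mL`, `12mL` and `mL`, in total `16mL ≤ x/2`. -/
theorem union_bound_le {m N : ℕ} (hm : 1 ≤ m) (hN : 3 * m ≤ N) {x : ℝ}
    (hx : 32 * (m * Real.log (N / m)) ≤ x) :
    (Real.exp 1 * ((N : ℝ) / (3 * m : ℕ))) ^ (3 * m) * (25 ^ (3 * m) * (2 * Real.exp (-x))) ≤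
      Real.exp (-(x / 2)) := by
  have hm0 : (0 : ℝ) < m := by exact_mod_cast hm
  have hm1 : (1 : ℝ) ≤ m := by exact_mod_cast hm
  have hN3 : (3 : ℝ) ≤ N / m := by
    rw [le_div_iff₀ hm0]; exact_mod_cast hN
  have hNm : (0 : ℝ) < N / m := by linarith
  have he3 : Real.exp 1 ≤ 3 := by linarith [Real.exp_one_lt_d9]
  set L := Real.log (N / m) with hL
  have hL1 : 1 ≤ L := by
    rw [hL, Real.le_log_iff_exp_le hNm]; linarith
  have h1 : (Real.exp 1 * ((N : ℝ) / (3 * m : ℕ))) ^ (3 * m) ≤ Real.exp (3 * m * L) := by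
    have : Real.exp 1 * ((N : ℝ) / (3 * m : ℕ)) ≤ Real.exp L := by
      rw [hL, Real.exp_log hNm]
      calc Real.exp 1 * ((N : ℝ) / (3 * m : ℕ)) ≤ 3 * ((N : ℝ) / (3 * m : ℕ)) := by gcongr
        _ = _ := by push_cast; field_simp
    calc _ ≤ Real.exp L ^ (3 * m) := by gcongr
      _ = _ := by rw [← Real.exp_nat_mul]; push_cast; rfl
  have h2 : (25 : ℝ) ^ (3 * m) ≤ Real.exp (12 * m * L) := by
    have h25 : (25 : ℝ) ≤ Real.exp 4 := by
      have h := Real.exp_one_gt_d9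
      have h4 : Real.exp 4 = Real.exp 1 ^ 4 := by rw [← Real.exp_nat_mul]; norm_num
      rw [h4]
      calc (25 : ℝ) ≤ 2.7 ^ 4 := by norm_num
        _ ≤ _ := by gcongr; linarith
    calc (25 : ℝ) ^ (3 * m) ≤ Real.exp 4 ^ (3 * m) := by gcongr
      _ = Real.exp (12 * m) := by rw [← Real.exp_nat_mul]; push_cast; ring_nf
      _ ≤ _ := Real.exp_le_exp.2 (le_mul_of_one_le_right (by positivity) hL1)
  have h3 : (2 : ℝ) ≤ Real.exp (m * L) := by
    have : (1 : ℝ) ≤ m * L := one_le_mul_of_one_le_of_one_le hm1 hL1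
    linarith [Real.add_one_le_exp (m * L)]
  calc _ ≤ Real.exp (3 * m * L) * (Real.exp (12 * m * L) * (Real.exp (m * L) * Real.exp (-x))) := by
        gcongr
    _ = Real.exp (16 * (m * L) - x) := by
        rw [← Real.exp_add, ← Real.exp_add, ← Real.exp_add]; ring_nf
    _ ≤ _ := Real.exp_le_exp.2 (by linarith)

theorem measureReal_satisfiesRIP_ge {m l k d e χ : ℕ} {Ω : Type*} [MeasurableSpace Ω]
    {μ : Measure Ω} [IsProbabilityMeasure μ] {B : Ω → ZMod k → Matrix (Fin d) (Fin e) ℝ}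
    {ν : Measure ℝ} [NeZero k] (hm : 1 ≤ m) (hmN : 3 * m ≤ k * e) (hn : 0 < l * d)
    (hν : IsEntryLaw (l * d) ν)
    (hind : iIndepFun (fun (p : ZMod k × Fin d × Fin e) (ω : Ω) => B ω p.1 p.2.1 p.2.2) μ)
    (hlaw : ∀ (i : ZMod k) (a : Fin d) (b : Fin e), HasLaw (fun ω => B ω i a b) ν μ)
    (hcol : ∀ T : Finset (Fin k × Fin e), T.card ≤ 3 * m →
      ∃ f : Fin l × Fin d → Fin χ, IsRowColoring T f)
    {δ : ℝ} (hδ : 0 < δ) (hδ1 : δ ≤ 1)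
    (hχ : 32 * (m * Real.log ((k * e : ℕ) / m)) ≤ δ ^ 2 / 524288 * ((l * d : ℕ) / χ)) :
    1 - Real.exp (-(δ ^ 2 / 524288 * ((l * d : ℕ) / χ) / 2)) ≤
      μ.real {ω | SatisfiesRIP (circulantBlock l k (B ω)) (3 * m) δ} := by
  have h1 := (measureReal_not_satisfiesRIP_le hn hν hind hlaw (s := 3 * m) (by omega) hmN hcol
    hδ hδ1).trans (union_bound_le hm hmN hχ)
  -- Subadditivity suffices here and avoids proving the event measurable.
  have h2 : (1 : ℝ) ≤ μ.real {ω | SatisfiesRIP (circulantBlock l k (B ω)) (3 * m) δ} +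
      μ.real {ω | ¬ SatisfiesRIP (circulantBlock l k (B ω)) (3 * m) δ} := by
    refine le_trans ?_ (measureReal_union_le _ _)
    rw [← probReal_univ (μ := μ)]
    exact measureReal_mono fun ω _ => em _
  linarith

theorem theorem2 (δ : ℝ) (hδ : δ ∈ Set.Ioo (0 : ℝ) 1) :
    ∃ c₁ > (0 : ℝ), ∃ c₂ > (0 : ℝ),
      ∀ (m l k d e n N : ℕ), 1 ≤ m → 1 ≤ l → l ≤ k → n = l * d → N = k * e → 3 * m ≤ N →
      ∀ (ν : Measure ℝ), IsEntryLaw n ν →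
      ∀ (Ω : Type*) [MeasurableSpace Ω] (μ : Measure Ω) [IsProbabilityMeasure μ]
        (B : Ω → ZMod k → Matrix (Fin d) (Fin e) ℝ),
        iIndepFun (fun (p : ZMod k × Fin d × Fin e) (ω : Ω) => B ω p.1 p.2.1 p.2.2) μ →
        (∀ (i : ZMod k) (a : Fin d) (b : Fin e), HasLaw (fun ω => B ω i a b) ν μ) →
        (l ≤ 3 * m * (3 * m - 1) →
          c₁ * l * m * Real.log ((N : ℝ) / m) ≤ n →
          1 - Real.exp (-c₂ * n / l) ≤
            μ.real {ω | SatisfiesRIP (circulantBlock l k (B ω)) (3 * m) δ}) ∧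
        (3 * m * (3 * m - 1) < l →
          c₁ * (m : ℝ) ^ 3 * Real.log ((N : ℝ) / m) ≤ n →
          1 - Real.exp (-c₂ * n / (m : ℝ) ^ 2) ≤
            μ.real {ω | SatisfiesRIP (circulantBlock l k (B ω)) (3 * m) δ}) := by
  obtain ⟨hδ0, hδ1⟩ := hδ
  set c : ℝ := δ ^ 2 / 524288 with hc
  have hc0 : 0 < c := by positivity
  -- `288 = 9 * 32` and `18 = 9 * 2`: the 9 pays for `3m(3m-1)+1 ≤ 9m²` colours, the 32 is the
  -- threshold of `union_bound_le`, and the 2 is the half of the exponent spent there.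
  refine ⟨288 / c, by positivity, c / 18, by positivity, ?_⟩
  rintro m l k d e n N hm hl hlk rfl rfl hmN ν hν Ω _ μ _ B hind hlaw
  have hm0 : (0 : ℝ) < m := by exact_mod_cast hm
  have hl0 : (0 : ℝ) < l := by exact_mod_cast hl
  have : NeZero k := ⟨by omega⟩
  set L := Real.log (((k * e : ℕ) : ℝ) / m) with hL
  have hL0 : 0 < L := Real.log_pos (by
    rw [one_lt_div hm0]; exact_mod_cast (by omega : m < k * e))
  refine ⟨fun _ hcond => ?_, fun _ hcond => ?_⟩
  -- The lower bound on `n` is positive and so rules out `d = 0`.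
  · have hn : (0 : ℝ) < (l * d : ℕ) := lt_of_lt_of_le (by positivity) hcond
    have h1 : 288 * (m * L) ≤ c * ((l * d : ℕ) / l) := by
      have h : 288 * (m * L) = c * ((288 / c * l * m * L) / l) := by field_simp
      rw [h]
      gcongr
    refine le_trans ?_ (measureReal_satisfiesRIP_ge hm hmN (by exact_mod_cast hn) hν hind hlaw
      (fun T _ => ⟨Prod.fst, isRowColoring_fst T⟩) hδ0 hδ1.le ?_)
    · refine sub_le_sub_left (Real.exp_le_exp.2 ?_) _
      have h2 : -(c / 18) * ((l * d : ℕ) : ℝ) / l = -(c * ((l * d : ℕ) / l) / 18) := by ring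
      have h3 : 0 ≤ c * (((l * d : ℕ) : ℝ) / l) := by positivity
      rw [h2, ← hc]
      linarith
    · rw [← hc, ← hL]
      have : 0 ≤ m * L := by positivity
      linarith
  · have hn : (0 : ℝ) < (l * d : ℕ) := lt_of_lt_of_le (by positivity) hcond
    have h1 : 288 * (m * L) ≤ c * ((l * d : ℕ) / (m : ℝ) ^ 2) := by
      have h : 288 * (m * L) = c * ((288 / c * (m : ℝ) ^ 3 * L) / (m : ℝ) ^ 2) := by field_simp
      rw [h]
      gcongr
    have h9 : ((3 * m * (3 * m - 1) + 1 : ℕ) : ℝ) ≤ 9 * (m : ℝ) ^ 2 := by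
      have : 3 * m * (3 * m - 1) + 1 ≤ 9 * m ^ 2 := by
        obtain ⟨j, rfl⟩ : ∃ j, m = j + 1 := ⟨m - 1, by omega⟩
        rw [show 3 * (j + 1) - 1 = 3 * j + 2 by omega]
        nlinarith
      exact_mod_cast this
    have h2 : c * ((l * d : ℕ) / (m : ℝ) ^ 2) / 9 ≤
        c * ((l * d : ℕ) / ((3 * m * (3 * m - 1) + 1 : ℕ) : ℝ)) := by
      calc c * ((l * d : ℕ) / (m : ℝ) ^ 2) / 9 = c * ((l * d : ℕ) / (9 * (m : ℝ) ^ 2)) := by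
            field_simp
        _ ≤ _ := by gcongr
    refine le_trans ?_ (measureReal_satisfiesRIP_ge hm hmN (by exact_mod_cast hn) hν hind hlaw
      (fun T hT => exists_isRowColoring d hlk T hT) hδ0 hδ1.le ?_)
    · refine sub_le_sub_left (Real.exp_le_exp.2 ?_) _
      have h3 : -(c / 18) * ((l * d : ℕ) : ℝ) / (m : ℝ) ^ 2 =
          -(c * ((l * d : ℕ) / (m : ℝ) ^ 2) / 18) := by ring
      rw [h3, ← hc]
      linarith
    · rw [← hc, ← hL]
      linarith
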